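/- Let $\mathbf{F}$ be the category of non-empty finite sets and all functions, and let $\mathbf{PSh}(\mathbf{F})=[\mathbf{F}^{\mathrm{op}},\mathbf{Set}]$ be the topos of symmetric (simplicial) sets. For $l\in\{-\infty<0<1<2<\dots<\infty\}$ let $\iota_l\colon\mathbf{F}_l\to\mathbf{F}$ be the inclusion of the full subcategory of the sets with at most $l+1$ elements (so $\mathbf{F}_{-\infty}$ is empty and $\mathbf{F}_{\infty}=\mathbf{F}$). The level labelled by $l$ is the adjoint triple $\mathrm{Lan}_{\iota_l}\dashv\iota_l^*\dashv\mathrm{Ran}_{\iota_l}$ between $\mathbf{PSh}(\mathbf{F}_l)$ and $\mathbf{PSh}(\mathbf{F})$; it induces the comonad $\mathrm{sk}_l=\mathrm{Lan}_{\iota_l}\iota_l^*$ and the monad $\mathrm{cosk}_l=\mathrm{Ran}_{\iota_l}\iota_l^*$ on $\mathbf{PSh}(\mathbf{F})$. A symmetric set $M$ is called $l$-skeletal if the counit $\mathrm{sk}_l M\to M$ is an isomorphism, and $l$-coskeletal if the unit $M\to\mathrm{cosk}_l M$ is an isomorphism. The Aufhebung of the level labelled by $l$ is the least $a_l\in\{-\infty,0,1,2,\dots,\infty\}$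 with $a_l\ge l$ such that every $l$-skeletal symmetric set is $a_l$-coskeletal. Theorem. The Aufhebung of the level labelled by $l$ is given by \[ a_l=\begin{cases}0&(l=-\infty)\\ 1&(l=0)\\ 2&(l=1)\\ 4&(l=2)\\ 2l-1&(3\le l<\infty).\end{cases} \] -/

import Mathlib

open CategoryTheory

universe u

namespace SymmSet

/-- The category `𝐅` of non-empty finite sets and all functions between them: the full subcategory
of the category of sets (in the universe `u`) on the non-empty finite ones. -/
abbrev FinNonempty : Type (u + 1) :=
  ObjectProperty.FullSubcategory (fun A : Type u => Finite A ∧ Nonempty A)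

/-- Symmetric (simplicial) sets: presheaves of sets on the category of non-empty finite sets. -/
abbrev SymmetricSet : Type (u + 1) :=
  FinNonempty.{u}ᵒᵖ ⥤ Type u

/-- The labels of the levels: the total order `-∞ < 0 < 1 < 2 < ⋯ < ∞`,
where `⊥` is `-∞` and `⊤` is `∞`. -/
abbrev Label : Type := WithBot ℕ∞

/-- A non-empty finite set `A` is of dimension at most `l` if `|A| ≤ l + 1`.
For `l = -∞` no `A` qualifies (as `-∞ + 1 = -∞`), and for `l = ∞` every `A` does. -/
def dimLE (l : Label) : ObjectProperty FinNonempty.{u} :=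
  fun A => ((Nat.card A.obj : ℕ∞) : Label) ≤ l + 1

/-- The full subcategory `𝐅_l` of `𝐅` on the sets with at most `l + 1` elements. It is empty for
`l = -∞`, and consists of all objects for `l = ∞`. -/
abbrev FinNonemptyLE (l : Label) : Type (u + 1) :=
  (dimLE.{u} l).FullSubcategory

/-- The inclusion functor `ι_l : 𝐅_l ⥤ 𝐅`. -/
abbrev incl (l : Label) : FinNonemptyLE.{u} l ⥤ FinNonempty.{u} :=
  (dimLE.{u} l).ι

/-- `𝐅` is essentially small: every object is isomorphic to (a lift of) some `Fin n`. -/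
instance essentiallySmall_finNonempty : EssentiallySmall.{u} FinNonempty.{u} := by
  have : ObjectProperty.EssentiallySmall.{u} (fun A : Type u => Finite A ∧ Nonempty A) := by
    refine ⟨ObjectProperty.ofObj (fun n : ℕ => ULift.{u} (Fin n)), inferInstance, ?_⟩
    rintro A ⟨hA, -⟩
    obtain ⟨n, ⟨e⟩⟩ := Finite.exists_equiv_fin A
    exact ⟨_, ⟨n⟩, ⟨(e.trans Equiv.ulift.symm).toIso⟩⟩
  infer_instance

instance essentiallySmall_finNonemptyLE (l : Label) :
    EssentiallySmall.{u} (FinNonemptyLE.{u} l) := by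
  have : ObjectProperty.EssentiallySmall.{u} (dimLE.{u} l) :=
    ObjectProperty.EssentiallySmall.of_le (Q := ⊤) le_top
  infer_instance

/-- Presheaves on `𝐅_l` admit (pointwise) left Kan extensions along `ι_l`. -/
instance hasPointwiseLan (l : Label) (G : (FinNonemptyLE.{u} l)ᵒᵖ ⥤ Type u) :
    (incl l).op.HasPointwiseLeftKanExtension G := fun Y =>
  have := Limits.hasColimitsOfShape_of_essentiallySmall.{u}
    (CostructuredArrow (incl.{u} l).op Y) (Type u)
  inferInstance

/-- Presheaves on `𝐅_l` admit (pointwise) right Kan extensions along `ι_l`. -/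
instance hasPointwiseRan (l : Label) (G : (FinNonemptyLE.{u} l)ᵒᵖ ⥤ Type u) :
    (incl l).op.HasPointwiseRightKanExtension G := fun Y =>
  have := Limits.hasLimitsOfShape_of_essentiallySmall.{u}
    (StructuredArrow Y (incl.{u} l).op) (Type u)
  inferInstance

/-- The adjunction `Lan_{ι_l} ⊣ ι_l^*` of the level of `PSh(𝐅)` labelled by `l`. -/
noncomputable abbrev lanAdj (l : Label) :
    (incl.{u} l).op.lan ⊣ (Functor.whiskeringLeft _ _ (Type u)).obj (incl.{u} l).op :=
  (incl l).op.lanAdjunction (Type u)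

/-- The adjunction `ι_l^* ⊣ Ran_{ι_l}` of the level of `PSh(𝐅)` labelled by `l`. -/
noncomputable abbrev ranAdj (l : Label) :
    (Functor.whiskeringLeft _ _ (Type u)).obj (incl.{u} l).op ⊣ (incl.{u} l).op.ran :=
  (incl l).op.ranAdjunction (Type u)

/-- The comonad `sk_l = Lan_{ι_l} ι_l^*` on symmetric sets induced by the level labelled by `l`. -/
noncomputable def sk (l : Label) : Comonad SymmetricSet.{u} :=
  (lanAdj l).toComonad

/-- The monad `cosk_l = Ran_{ι_l} ι_l^*` on symmetric sets induced by the level labelled by `l`. -/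
noncomputable def cosk (l : Label) : Monad SymmetricSet.{u} :=
  (ranAdj l).toMonad

/-- `M` is `l`-skeletal if the counit `sk_l M ⟶ M` is invertible. -/
def IsSkeletal (l : Label) (M : SymmetricSet.{u}) : Prop :=
  IsIso ((sk l).ε.app M)

/-- `M` is `l`-coskeletal if the unit `M ⟶ cosk_l M` is invertible. -/
def IsCoskeletal (l : Label) (M : SymmetricSet.{u}) : Prop :=
  IsIso ((cosk l).η.app M)

/-- `a` is the Aufhebung of (the level labelled by) `l`: it is the least label `a ≥ l` such that
every `l`-skeletal symmetric set is `a`-coskeletal. -/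
def IsAufhebung (l a : Label) : Prop :=
  IsLeast {b : Label | l ≤ b ∧ ∀ M : SymmetricSet.{u}, IsSkeletal l M → IsCoskeletal b M} a

end SymmSet

namespace SymmSet

open Opposite Function

/-! ### Hom-set criteria for units and counits -/

/-! By the Eilenberg-Zilber property every element is the pullback, along a surjection, of a
non-degenerate element, its root. A symmetric set is `l`-skeletal exactly when all roots live over
sets with at most `l + 1` elements, and it is `b`-coskeletal if every compatible family indexed by
maps `B → A` with `|B| ≤ b + 1` has a unique filler.

Upper bound. Comparing roots makes fillers unique. For existence, induction on `|A|` gives a family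
indexed by all sets smaller than `A`. Let `u`, at `g : B → A`, be a non-degenerate member with `|B|`
maximal. On a proper subset of `A` containing the range of `g`, the family is the pullback of `u`
along a unique retraction of `g`; these retractions glue to `f : A → B`, and the filler is the
pullback of `u` along `f`. It remains to compare the two on the complement of a point `i` in the
range. If `i` is not alone in its fibre of `f`, then `g` can be moved off `i`
(`Family.val_eq_pull_of_apply_eq`); otherwise fibres are counted
(`Family.exists_isFilledBy_of_nondeg`). The argument needs `l + 1 ≤ a`, `l + 2 ≤ a` unless `l ≤ 1`,
and `2 * l ≤ a + 1`; the least such `a` is the stated value.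

Lower bound. `transversalSystem l` fails to be `b`-coskeletal as soon as some `V` with more than `b
+ 1` points carries a set of `(l + 1)`-tuples that is an element of it away from any one point, but
not globally. The examples are two points, three points, a pentagon, and two disjoint `l`-element
sets. -/

/-- The hom-set bijection turns `L.map` into composition with the unit. Together with the dual
statement this removes Kan extensions from the problem: only restriction of natural transformations
remains. -/
theorem isIso_unit_app_iff_bijective_map {C D : Type*} [Category C] [Category D] {L : C ⥤ D}
    {R : D ⥤ C} (adj : L ⊣ R) (Y : C) :
    IsIso (adj.unit.app Y) ↔ ∀ X : C, Bijective (fun f : X ⟶ Y => L.map f) := by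
  rw [isIso_iff_yoneda_map_bijective]
  refine forall_congr' fun X => ?_
  rw [← Bijective.of_comp_iff' (adj.homEquiv X (L.obj Y)).bijective]
  have : (fun f : X ⟶ Y => f ≫ adj.unit.app Y) =
      adj.homEquiv X (L.obj Y) ∘ fun f : X ⟶ Y => L.map f := by
    funext f
    simp [Adjunction.homEquiv_unit]
  rw [← this]
  rfl

theorem isIso_counit_app_iff_bijective_map {C D : Type*} [Category C] [Category D] {L : C ⥤ D}
    {R : D ⥤ C} (adj : L ⊣ R) (X : D) :
    IsIso (adj.counit.app X) ↔ ∀ Y : D, Bijective (fun f : X ⟶ Y => R.map f) := by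
  rw [isIso_iff_coyoneda_map_bijective]
  refine forall_congr' fun Y => ?_
  rw [← Bijective.of_comp_iff' (adj.homEquiv (R.obj X) Y).symm.bijective]
  have : (fun f : X ⟶ Y => adj.counit.app X ≫ f) =
      (adj.homEquiv (R.obj X) Y).symm ∘ fun f : X ⟶ Y => R.map f := by
    funext f
    simp [Adjunction.homEquiv_counit]
  rw [← this]
  rfl

/-! ### Elements of symmetric sets -/

/-- A non-empty finite type as an object of `𝐅`. -/
abbrev of (A : Type u) [Finite A] [Nonempty A] : FinNonempty.{u} := ⟨A, ‹_›, ‹_›⟩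

/-- A function as a morphism of `𝐅`. -/
abbrev homOf {A B : Type u} [Finite A] [Nonempty A] [Finite B] [Nonempty B] (f : A → B) :
    of A ⟶ of B := ObjectProperty.homMk (TypeCat.ofHom f)

/-- The set of elements of `M` at `A`. -/
def El (M : SymmetricSet.{u}) (A : Type u) [Finite A] [Nonempty A] : Type u := M.obj (op (of A))

/-- The action of a function on the elements of a symmetric set. -/
def pull (M : SymmetricSet.{u}) {A B : Type u} [Finite A] [Nonempty A] [Finite B] [Nonempty B]
    (f : A → B) (y : El M B) : El M A := M.map (homOf f).op y

section

variable (M : SymmetricSet.{u}) {A B C : Type u} [Finite A] [Nonempty A] [Finite B] [Nonempty B]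
  [Finite C] [Nonempty C]

theorem pull_id (x : El M A) : pull M id x = x :=
  congrArg (fun φ => (ConcreteCategory.hom φ : El M A → El M A) x) (M.map_id (op (of A)))

theorem pull_pull (f : A → B) (g : B → C) (z : El M C) :
    pull M f (pull M g z) = pull M (g ∘ f) z :=
  (congrArg (fun φ => (ConcreteCategory.hom φ : El M C → El M A) z)
    (M.map_comp (homOf g).op (homOf f).op)).symm

/-- The action of a natural transformation on elements. -/
def app {M N : SymmetricSet.{u}} (φ : M ⟶ N) (A : Type u) [Finite A] [Nonempty A] (x : El M A) :
    El N A := φ.app (op (of A)) x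

theorem app_pull {M N : SymmetricSet.{u}} (φ : M ⟶ N) (f : A → B) (y : El M B) :
    app φ A (pull M f y) = pull N f (app φ B y) :=
  congrArg (fun ψ => (ConcreteCategory.hom ψ : El M B → El N A) y) (φ.naturality (homOf f).op)

end

/-- A natural transformation from its action on elements. -/
def homMk {M N : SymmetricSet.{u}}
    (φ : ∀ (A : Type u) [Finite A] [Nonempty A], El M A → El N A)
    (hφ : ∀ (A B : Type u) [Finite A] [Nonempty A] [Finite B] [Nonempty B] (f : A → B)
      (y : El M B), φ A (pull M f y) = pull N f (φ B y)) : M ⟶ N where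
  app X := TypeCat.ofHom fun x =>
    have := X.unop.property.1
    have := X.unop.property.2
    φ X.unop.obj x
  naturality X Y f := by
    ext x
    have := X.unop.property.1
    have := X.unop.property.2
    have := Y.unop.property.1
    have := Y.unop.property.2
    exact hφ Y.unop.obj X.unop.obj (ConcreteCategory.hom f.unop.hom) x

theorem hom_ext {M N : SymmetricSet.{u}} {φ ψ : M ⟶ N}
    (h : ∀ (A : Type u) [Finite A] [Nonempty A] (x : El M A), app φ A x = app ψ A x) : φ = ψ := by
  ext X x
  have := X.unop.property.1
  have := X.unop.property.2
  exact h X.unop.obj x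

/-! ### Restriction to sets of bounded size -/

/-- The restriction functor along `ι_l`. -/
abbrev res (l : Label) : SymmetricSet.{u} ⥤ ((FinNonemptyLE.{u} l)ᵒᵖ ⥤ Type u) :=
  (Functor.whiskeringLeft _ _ (Type u)).obj (incl.{u} l).op

/-- `A` has at most `l + 1` elements. -/
def Small (l : Label) (A : Type u) : Prop := ((Nat.card A : ℕ∞) : Label) ≤ l + 1

section

variable {l : Label} {M N : SymmetricSet.{u}}

/-- The action on elements of a natural transformation between restrictions. -/
def resApp (φ : (res l).obj M ⟶ (res l).obj N) (A : Type u) [Finite A] [Nonempty A]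
    (hA : Small l A) (x : El M A) : El N A := φ.app (op ⟨of A, hA⟩) x

theorem resApp_pull (φ : (res l).obj M ⟶ (res l).obj N) {A B : Type u} [Finite A] [Nonempty A]
    [Finite B] [Nonempty B] (hA : Small l A) (hB : Small l B) (f : A → B) (y : El M B) :
    resApp φ A hA (pull M f y) = pull N f (resApp φ B hB y) :=
  congrArg (fun ψ => (ConcreteCategory.hom ψ : El M B → El N A) y)
    (φ.naturality (X := op ⟨of B, hB⟩) (Y := op ⟨of A, hA⟩)
      (Quiver.Hom.op (ObjectProperty.homMk (homOf f))))

theorem resApp_map (φ : M ⟶ N) (A : Type u) [Finite A] [Nonempty A] (hA : Small l A) (x : El M A) :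
    resApp ((res l).map φ) A hA x = app φ A x := rfl

theorem res_hom_ext {φ ψ : (res l).obj M ⟶ (res l).obj N}
    (h : ∀ (A : Type u) [Finite A] [Nonempty A] (hA : Small l A) (x : El M A),
      resApp φ A hA x = resApp ψ A hA x) : φ = ψ := by
  ext X x
  have := X.unop.obj.property.1
  have := X.unop.obj.property.2
  exact h X.unop.obj.obj X.unop.property x

/-- A natural transformation between restrictions from its action on elements. -/
def resHomMk (φ : ∀ (A : Type u) [Finite A] [Nonempty A], Small l A → El M A → El N A)
    (hφ : ∀ (A B : Type u) [Finite A] [Nonempty A] [Finite B] [Nonempty B] (hA : Small l A)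
      (hB : Small l B) (f : A → B) (y : El M B), φ A hA (pull M f y) = pull N f (φ B hB y)) :
    (res l).obj M ⟶ (res l).obj N where
  app X := TypeCat.ofHom fun x =>
    have := X.unop.obj.property.1
    have := X.unop.obj.property.2
    φ X.unop.obj.obj X.unop.property x
  naturality X Y f := by
    ext x
    have := X.unop.obj.property.1
    have := X.unop.obj.property.2
    have := Y.unop.obj.property.1
    have := Y.unop.obj.property.2
    exact hφ Y.unop.obj.obj X.unop.obj.obj Y.unop.property X.unop.property
      (ConcreteCategory.hom f.unop.hom.hom) x

theorem isSkeletal_iff_bijective :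
    IsSkeletal l M ↔ ∀ N, Bijective (fun f : M ⟶ N => (res l).map f) :=
  isIso_counit_app_iff_bijective_map (lanAdj l) M

theorem isCoskeletal_iff_bijective :
    IsCoskeletal l M ↔ ∀ N, Bijective (fun f : N ⟶ M => (res l).map f) :=
  isIso_unit_app_iff_bijective_map (ranAdj l) M

end

/-! ### Elementary descriptions of skeletal and coskeletal symmetric sets -/

/-- The element `x` is the pullback of an element over a set with at most `l + 1` elements. -/
def FactorsThrough (l : Label) (M : SymmetricSet.{u}) {A : Type u} [Finite A] [Nonempty A]
    (x : El M A) : Prop :=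
  ∃ (B : Type u) (_ : Finite B) (_ : Nonempty B) (f : A → B) (y : El M B),
    Small l B ∧ x = pull M f y

/-- A symmetric set from its sets of elements and the action of functions on them. -/
def ofAction (E : ∀ (A : Type u) [Finite A] [Nonempty A], Type u)
    (act : ∀ {A B : Type u} [Finite A] [Nonempty A] [Finite B] [Nonempty B], (A → B) → E B → E A)
    (act_id : ∀ {A : Type u} [Finite A] [Nonempty A] (x : E A), act id x = x)
    (act_act : ∀ {A B C : Type u} [Finite A] [Nonempty A] [Finite B] [Nonempty B] [Finite C]
      [Nonempty C] (f : A → B) (g : B → C) (z : E C), act f (act g z) = act (g ∘ f) z) :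
    SymmetricSet.{u} where
  obj X :=
    have := X.unop.property.1
    have := X.unop.property.2
    E X.unop.obj
  map {X Y} f := TypeCat.ofHom fun x =>
    have := X.unop.property.1
    have := X.unop.property.2
    have := Y.unop.property.1
    have := Y.unop.property.2
    act (ConcreteCategory.hom f.unop.hom) x
  map_id X := by
    ext x
    have := X.unop.property.1
    have := X.unop.property.2
    exact act_id x
  map_comp {X Y Z} f g := by
    ext x
    have := X.unop.property.1
    have := X.unop.property.2
    have := Y.unop.property.1
    have := Y.unop.property.2
    have := Z.unop.property.1
    have := Z.unop.property.2
    exact (act_act (ConcreteCategory.hom g.unop.hom) (ConcreteCategory.hom f.unop.hom) x).symm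

/-- The part of `M` consisting of the elements coming from sets with at most `l + 1` elements. -/
def skPart (l : Label) (M : SymmetricSet.{u}) : SymmetricSet.{u} :=
  ofAction (fun A _ _ => { x : El M A // FactorsThrough l M x })
    (fun f x => ⟨pull M f x.1, by
      obtain ⟨B, _, _, g, y, hB, hx⟩ := x.2
      exact ⟨B, _, _, _, y, hB, by rw [hx, pull_pull]⟩⟩)
    (fun x => Subtype.ext (pull_id M x.1))
    (fun f g z => Subtype.ext (pull_pull M f g z.1))

/-- `M` and `skPart l M` agree on small sets. Skeletality extends this identification to a map `M ⟶
skPart l M`, which is a section of the inclusion because it is one on small sets. -/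
theorem factorsThrough_of_isSkeletal {l : Label} {M : SymmetricSet.{u}} (h : IsSkeletal l M)
    {A : Type u} [Finite A] [Nonempty A] (x : El M A) : FactorsThrough l M x := by
  rw [isSkeletal_iff_bijective] at h
  let i : skPart l M ⟶ M := homMk (fun A _ _ x => x.1) (fun _ _ _ _ _ _ _ _ => rfl)
  let r : (res l).obj M ⟶ (res l).obj (skPart l M) :=
    resHomMk (fun A _ _ hA x => ⟨x, A, _, _, id, x, hA, (pull_id M x).symm⟩)
      (fun _ _ _ _ _ _ _ _ _ _ => rfl)
  obtain ⟨s, hs⟩ := (h (skPart l M)).2 r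
  have hsi : s ≫ i = 𝟙 M := by
    apply (h M).1
    dsimp only at hs ⊢
    rw [Functor.map_comp, hs]
    rfl
  have : (app s A x).1 = x := congrArg (fun φ => app φ A x) hsi
  rw [← this]
  exact (app s A x).2

/-- A natural family of elements of `M`, indexed by the functions to `A` from the sets satisfying
`P`. -/
structure Family (M : SymmetricSet.{u}) (P : Type u → Prop) (A : Type u) where
  /-- the members of the family -/
  val : ∀ (B : Type u) [Finite B] [Nonempty B], P B → (B → A) → El M B
  pull_val : ∀ (B C : Type u) [Finite B] [Nonempty B] [Finite C] [Nonempty C] (hB : P B) (hC : P C)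
    (f : B → C) (g : C → A), pull M f (val C hC g) = val B hB (g ∘ f)

/-- The element `x` fills the family `X`. -/
def Family.IsFilledBy {M : SymmetricSet.{u}} {P : Type u → Prop} {A : Type u} [Finite A]
    [Nonempty A] (X : Family M P A) (x : El M A) : Prop :=
  ∀ (B : Type u) [Finite B] [Nonempty B] (hB : P B) (g : B → A), pull M g x = X.val B hB g

/-- By Yoneda, a family is a map out of the restriction of the presheaf represented by `A`; the
filler is the image of the identity under its extension. -/
theorem exists_isFilledBy_of_isCoskeletal {l : Label} {M : SymmetricSet.{u}}
    (h : IsCoskeletal l M) {A : Type u} [Finite A] [Nonempty A] (X : Family M (Small l) A) :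
    ∃ x, X.IsFilledBy x := by
  rw [isCoskeletal_iff_bijective] at h
  let r : (res l).obj (yoneda.obj (of A)) ⟶ (res l).obj M :=
    resHomMk (fun B _ _ hB g => X.val B hB (ConcreteCategory.hom (C := Type u)
      (InducedCategory.Hom.hom (show of B ⟶ of A from g))))
      (fun _ _ _ _ _ _ hA hB f g => (X.pull_val _ _ hA hB f _).symm)
  obtain ⟨s, hs⟩ := (h _).2 r
  refine ⟨app s A (show El (yoneda.obj (of A)) A from 𝟙 (of A)), fun B _ _ hB g => ?_⟩
  refine (app_pull s g _).symm.trans ?_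
  exact congrArg (fun θ => resApp θ B hB (pull (yoneda.obj (of A)) g _)) hs

theorem isCoskeletal_of_existsUnique {l : Label} {M : SymmetricSet.{u}}
    (h : ∀ (A : Type u) [Finite A] [Nonempty A] (X : Family M (Small l) A),
      ∃! x, X.IsFilledBy x) : IsCoskeletal l M := by
  rw [isCoskeletal_iff_bijective]
  intro N
  constructor
  · intro φ ψ hφψ
    refine hom_ext fun A _ _ x => ?_
    let X : Family M (Small l) A :=
      ⟨fun B _ _ hB g => app φ B (pull N g x), fun B C _ _ _ _ hB hC f g => by
        rw [← app_pull, pull_pull]⟩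
    refine (h A X).unique (fun B _ _ hB g => (app_pull _ _ _).symm) fun B _ _ hB g => ?_
    rw [← app_pull]
    exact congrArg (fun θ => resApp θ B hB (pull N g x)) hφψ.symm
  · intro r
    let X (A : Type u) [Finite A] [Nonempty A] (y : El N A) : Family M (Small l) A :=
      ⟨fun B _ _ hB g => resApp r B hB (pull N g y), fun B C _ _ _ _ hB hC f g => by
        rw [← resApp_pull r hB hC, pull_pull]⟩
    choose F hF using fun (A : Type u) (_ : Finite A) (_ : Nonempty A) (y : El N A) =>
      (h A (X A y)).exists
    refine ⟨homMk (fun A _ _ y => F A _ _ y) fun A B _ _ _ _ f y => ?_, ?_⟩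
    · refine (h A (X A (pull N f y))).unique (hF _ _ _ _) fun C _ _ hC g => ?_
      rw [pull_pull, hF _ _ _ _ C hC]
      simp only [X, pull_pull]
    · refine res_hom_ext fun A _ _ hA x => ?_
      have := hF A _ _ x A hA id
      rw [pull_id] at this
      simp only [X, pull_id] at this
      exact this

/-! ### Non-degenerate elements -/

theorem exists_section {A B : Type*} {q : A → B} (hq : Surjective q) : ∃ s : B → A, q ∘ s = id :=
  ⟨surjInv hq, funext (surjInv_eq hq)⟩

/-- An element is non-degenerate if it is only a pullback along injections. -/
def Nondeg (M : SymmetricSet.{u}) {B : Type u} [Finite B] [Nonempty B] (y : El M B) : Prop :=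
  ∀ (C : Type u) [Finite C] [Nonempty C] (g : B → C) (z : El M C), y = pull M g z → Injective g

/-- The Eilenberg-Zilber property: an element with a root over `B` that is compared, on all
sections of the quotient map, with an element coming from a set that is not larger than `B`. -/
theorem Nondeg.comp_section_comp {M : SymmetricSet.{u}} {A B C : Type u} [Finite B] [Nonempty B]
    [Finite C] [Nonempty C] {u : El M B} (hu : Nondeg M u) {q : A → B} {p : A → C}
    {v : El M C} (hc : Nat.card C ≤ Nat.card B)
    (h : ∀ s : B → A, q ∘ s = id → u = pull M (p ∘ s) v) {s : B → A} (hs : q ∘ s = id) :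
    p ∘ s ∘ q = p := by
  classical
  funext a
  have hs' : q ∘ update s (q a) a = id := by
    funext b
    by_cases hb : b = q a
    · subst hb; simp
    · simpa [hb] using congrFun hs b
  have hi := hu C _ v (h s hs)
  have hi' := hu C _ v (h _ hs')
  -- So `p a = p (s b)` for some `b`. If `b ≠ q a`, the section changed at `q a` to the value `a`
  -- would still hit `p a` at `b`, and also at `q a`, against injectivity.
  have hsurj : Surjective (p ∘ s) :=
    ((Nat.bijective_iff_injective_and_card _).2
      ⟨hi, le_antisymm (Nat.card_le_card_of_injective _ hi) hc⟩).2
  obtain ⟨b, hb⟩ := hsurj (p a)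
  by_cases hba : b = q a
  · subst hba; exact hb
  · exact absurd (hi' (a₁ := b) (a₂ := q a) (by simpa [hba] using hb)) hba

section

variable {M : SymmetricSet.{u}} {A B C D : Type u} [Finite A] [Nonempty A] [Finite B] [Nonempty B]
  [Finite C] [Nonempty C] [Finite D] [Nonempty D]

/-- A degenerate element comes from the range of a non-injective map, which is strictly smaller, so
the induction applies there. -/
theorem exists_root (x : El M A) :
    ∃ (B : Type u) (_ : Finite B) (_ : Nonempty B) (q : A → B) (y : El M B),
      Surjective q ∧ Nondeg M y ∧ x = pull M q y := by
  induction hn : Nat.card A using Nat.strong_induction_on generalizing A with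
  | _ n ih =>
    by_cases hx : Nondeg M x
    · exact ⟨A, _, _, id, x, surjective_id, hx, (pull_id M x).symm⟩
    · simp only [Nondeg, not_forall] at hx
      obtain ⟨C, _, _, g, z, rfl, hg⟩ := hx
      have hlt : Nat.card (Set.range g) < n := by
        rw [← hn]
        refine lt_of_le_of_ne (Nat.card_le_card_of_surjective _ Set.rangeFactorization_surjective) ?_
        intro h
        have := ((Nat.bijective_iff_surjective_and_card _).2
          ⟨Set.rangeFactorization_surjective (f := g), h.symm⟩).1
        exact hg ((Subtype.val_injective.comp this :))
      obtain ⟨B, _, _, q, y, hq, hy, h⟩ := ih _ hlt (pull M Subtype.val z) rfl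
      refine ⟨B, _, _, q ∘ Set.rangeFactorization g, y,
        hq.comp Set.rangeFactorization_surjective, hy, ?_⟩
      rw [← pull_pull, ← h, pull_pull]
      rfl

theorem Nondeg.card_le {y : El M B} (hy : Nondeg M y) {g : B → C} {z : El M C}
    (h : y = pull M g z) : Nat.card B ≤ Nat.card C :=
  Nat.card_le_card_of_injective _ (hy C g z h)

/-- Two elements agree if they agree on all sets at least as small as their roots. -/
theorem eq_of_forall_pull_eq {k : ℕ} {x y : El M A}
    (hx : ∃ (B : Type u) (_ : Finite B) (_ : Nonempty B) (f : A → B) (z : El M B),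
      Nat.card B ≤ k ∧ x = pull M f z)
    (hy : ∃ (B : Type u) (_ : Finite B) (_ : Nonempty B) (f : A → B) (z : El M B),
      Nat.card B ≤ k ∧ y = pull M f z)
    (h : ∀ (B : Type u) [Finite B] [Nonempty B] (g : B → A), Nat.card B ≤ k →
      pull M g x = pull M g y) : x = y := by
  obtain ⟨B, _, _, q, u, hq, hu, hxq⟩ := exists_root x
  obtain ⟨C, _, _, p, v, hp, hv, hyp⟩ := exists_root y
  obtain ⟨s, hs⟩ := exists_section hq
  obtain ⟨t, ht⟩ := exists_section hp
  have hus {s : B → A} (hs : q ∘ s = id) : u = pull M s x := by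
    rw [hxq, pull_pull, hs, pull_id]
  have hvt : v = pull M t y := by
    rw [hyp, pull_pull, ht, pull_id]
  have hBk : Nat.card B ≤ k := by
    obtain ⟨E, _, _, f, z, hE, hz⟩ := hx
    refine le_trans ?_ hE
    refine hu.card_le (g := f ∘ s) (z := z) ?_
    rw [hus hs, hz, pull_pull]
  have hCk : Nat.card C ≤ k := by
    obtain ⟨E, _, _, f, z, hE, hz⟩ := hy
    refine le_trans ?_ hE
    refine hv.card_le (g := f ∘ t) (z := z) ?_
    rw [hvt, hz, pull_pull]
  have hCB : Nat.card C ≤ Nat.card B := by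
    refine hv.card_le (g := q ∘ t) (z := u) ?_
    rw [hvt, ← h C t hCk, hxq, pull_pull]
  have key {s : B → A} (hs : q ∘ s = id) : u = pull M (p ∘ s) v := by
    rw [hus hs, h B s hBk, hyp, pull_pull]
  have hpsq := hu.comp_section_comp hCB (fun s hs => key hs) hs
  rw [hxq, key hs, pull_pull, comp_assoc, hpsq, hyp]

/-- An element with root at most as large as `B` that restricts to a non-degenerate element along
`j : B → D` is the pullback of that element along a retraction of `j`. -/
theorem Nondeg.exists_retraction {u : El M B} (hu : Nondeg M u) {x : El M D} {j : B → D}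
    (hj : pull M j x = u) {q : D → C} {y : El M C} (hc : Nat.card C ≤ Nat.card B)
    (hx : x = pull M q y) : ∃ r : D → B, r ∘ j = id ∧ x = pull M r u := by
  have h : u = pull M (q ∘ j) y := by rw [← hj, hx, pull_pull]
  have hi := hu C _ _ h
  let e := Equiv.ofBijective _ ((Nat.bijective_iff_injective_and_card (q ∘ j)).2
      ⟨hi, le_antisymm (Nat.card_le_card_of_injective _ hi) hc⟩)
  refine ⟨e.symm ∘ q, funext fun b => e.symm_apply_apply b, ?_⟩
  rw [h, pull_pull, hx]
  congr 1
  funext d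
  exact (e.apply_symm_apply (q d)).symm

/-- Every section `s` of `r` pulls the common element back to `u`, so the Eilenberg-Zilber property
gives `r' ∘ j ∘ r = r'`. -/
theorem Nondeg.retraction_unique {u : El M B} (hu : Nondeg M u) {j : B → D} {r r' : D → B}
    (hr : r ∘ j = id) (hr' : r' ∘ j = id) (h : pull M r u = pull M r' u) : r = r' := by
  have := hu.comp_section_comp (q := r) (p := r') (v := u) le_rfl (fun s hs => by
    rw [← pull_pull, ← h, pull_pull, hs, pull_id]) hr
  rw [← comp_assoc, hr', id_comp] at this
  exact this

theorem Nondeg.eq_of_pull_update_eq [DecidableEq B] {u : El M B} (hu : Nondeg M u) {b c : B}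
    (h : u = pull M (update id b c) u) : c = b := by
  by_contra hcb
  have := hu B _ _ h
  exact hcb (this (by simp [hcb]))

/-- If `k' ≠ k''`, alternating between `x` and `y` exhibits `x` as its own pullback along a map
sending both `k` and `k''` to `k'`. Hence `x` is fixed by replacing `k` with `k''`, as `y` is, and
this replacement misses `k`, where `x` and `y` can be compared. -/
theorem eq_of_pull_update_eq [DecidableEq D] {x y : El M D} {k k' k'' : D} (hk' : k' ≠ k)
    (hk'' : k'' ≠ k)
    (hk : ∀ h : D → D, (∀ d, h d ≠ k) → pull M h x = pull M h y)
    (hkk : ∀ h : D → D, (∀ d, h d ≠ k'') → pull M h x = pull M h y)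
    (hx : pull M (update id k k') x = x) (hy : pull M (update id k k'') y = y)
    (hy' : pull M (update id k'' k) y = y) : x = y := by
  have miss {a b : D} (hab : b ≠ a) (d : D) : update id a b d ≠ a := by
    by_cases hd : d = a
    · simp [hd, hab]
    · simp [hd]
  by_cases hkk' : k' = k''
  · subst hkk'
    rw [← hx, hk _ (miss hk'), hy]
  · have h1 : x = pull M (update id k k' ∘ update id k'' k ∘ update id k k') x := by
      conv_lhs => rw [← hx, hk _ (miss hk'), ← hy', pull_pull,
        ← hkk (update id k'' k ∘ update id k k') (fun d => miss hk''.symm _), ← hx, pull_pull]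
    have h2 : (update id k k' ∘ update id k'' k ∘ update id k k') ∘ update id k k'' =
        update id k k' ∘ update id k'' k ∘ update id k k' := by
      funext d
      by_cases hd : d = k
      · subst hd; simp [hkk', hk', hk'']
      · simp [hd]
    calc x = _ := h1
      _ = pull M (update id k k'') x := by
        conv_rhs => rw [h1, pull_pull, h2]
      _ = y := by rw [hk _ (miss hk''), hy]

end

/-! ### Skeletal symmetric sets -/

theorem Small.mono {l : Label} {A B : Type u} (hB : Small l B) (h : Nat.card A ≤ Nat.card B) :
    Small l A :=
  le_trans (by exact_mod_cast h) hB

theorem isSkeletal_of_factorsThrough {l : Label} {M : SymmetricSet.{u}}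
    (h : ∀ (A : Type u) [Finite A] [Nonempty A] (x : El M A), FactorsThrough l M x) :
    IsSkeletal l M := by
  rw [isSkeletal_iff_bijective]
  intro N
  constructor
  · intro φ ψ hφψ
    refine hom_ext fun A _ _ x => ?_
    obtain ⟨B, _, _, f, y, hB, rfl⟩ := h A x
    rw [app_pull, app_pull]
    exact congrArg (fun θ => pull N f (resApp θ B hB y)) hφψ
  · intro ψ
    -- The extension of `ψ` is forced to be `pull N f (ψ y)` on `pull M f y`. It is well defined
    -- because every such expression reduces to the one at the root.
    have key (A B C : Type u) [Finite A] [Nonempty A] [Finite B] [Nonempty B] [Finite C]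
        [Nonempty C] (hB : Small l B) (hC : Small l C) (f : A → C) (y : El M C) (q : A → B)
        (u : El M B) (hq : Surjective q) (hu : Nondeg M u) (hfq : pull M f y = pull M q u) :
        pull N f (resApp ψ C hC y) = pull N q (resApp ψ B hB u) := by
      obtain ⟨D, _, _, p, w, hp, hw, hpw⟩ := exists_root (pull M (Subtype.val : Set.range f → C) y)
      have hR : Small l (Set.range f) :=
        hC.mono (Nat.card_le_card_of_injective _ Subtype.val_injective)
      have hD : Small l D := hR.mono (Nat.card_le_card_of_surjective _ hp)
      let p' := p ∘ Set.rangeFactorization f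
      have hf : f = Subtype.val ∘ Set.rangeFactorization f := rfl
      have h1 : pull N f (resApp ψ C hC y) = pull N p' (resApp ψ D hD w) := by
        conv_lhs => rw [hf, ← pull_pull, ← resApp_pull ψ hR hC, hpw, resApp_pull ψ hR hD, pull_pull]
      have h2 : pull M q u = pull M p' w := by
        rw [← hfq]
        conv_lhs => rw [hf, ← pull_pull, hpw, pull_pull]
      have hu' {s : B → A} (hs : q ∘ s = id) : u = pull M (p' ∘ s) w := by
        rw [← pull_pull, ← h2, pull_pull, hs, pull_id]
      obtain ⟨t, ht⟩ := exists_section (hp.comp (Set.rangeFactorization_surjective (f := f)))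
      have hDB : Nat.card D ≤ Nat.card B := by
        refine hw.card_le (g := q ∘ t) (z := u) ?_
        rw [← pull_pull, h2, pull_pull, ht, pull_id]
      obtain ⟨s, hs⟩ := exists_section hq
      have := hu.comp_section_comp hDB (fun s hs => hu' hs) hs
      rw [h1, hu' hs, resApp_pull ψ hB hD, pull_pull, comp_assoc, this]
    have key' (A B C : Type u) [Finite A] [Nonempty A] [Finite B] [Nonempty B] [Finite C]
        [Nonempty C] (hB : Small l B) (hC : Small l C) (f : A → C) (y : El M C) (q : A → B)
        (u : El M B) (hfq : pull M f y = pull M q u) :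
        pull N f (resApp ψ C hC y) = pull N q (resApp ψ B hB u) := by
      obtain ⟨D, _, _, p, w, hp, hw, hpw⟩ := exists_root (pull M f y)
      have hD : Small l D := by
        obtain ⟨t, ht⟩ := exists_section hp
        refine hB.mono (hw.card_le (g := q ∘ t) (z := u) ?_)
        rw [← pull_pull, ← hfq, hpw, pull_pull, ht, pull_id]
      rw [key A D C hD hC f y p w hp hw hpw, key A D B hD hB q u p w hp hw (hfq ▸ hpw)]
    choose B hB1 hB2 f y hB hx using h
    refine ⟨homMk (fun A _ _ x => @pull N _ _ _ _ (hB1 A x) (hB2 A x) (f A x)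
      (@resApp l M N ψ _ (hB1 A x) (hB2 A x) (hB A x) (y A x))) ?_, ?_⟩
    · intro A A' _ _ _ _ g x
      have := hB1 A (pull M g x)
      have := hB2 A (pull M g x)
      have := hB1 A' x
      have := hB2 A' x
      rw [pull_pull]
      refine key' _ _ _ _ _ _ _ _ _ ?_
      rw [← hx, ← pull_pull, ← hx]
    · refine res_hom_ext fun A _ _ hA x => ?_
      have := hB1 A x
      have := hB2 A x
      rw [resApp_map]
      refine (key' _ _ _ hA (hB A x) (f A x) (y A x) id x ?_).trans (pull_id _ _)
      rw [← hx, pull_id]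

/-! ### Filling families indexed by smaller sets -/

theorem ne_univ_of_ncard_lt {A : Type*} {s : Set A} (h : s.ncard < Nat.card A) :
    s ≠ Set.univ := by
  rintro rfl
  rw [Set.ncard_univ] at h
  exact lt_irrefl _ h

theorem ncard_range_le {A B : Type*} [Finite B] (g : B → A) :
    (Set.range g).ncard ≤ Nat.card B := by
  rw [← Set.image_univ, ← Set.ncard_univ]
  exact Set.ncard_image_le

theorem card_lt_of_ne_univ {A : Type*} [Finite A] {s : Set A} (h : s ≠ Set.univ) : Nat.card s < Nat.card A := by
  rw [Nat.card_coe_set_eq, ← Set.ncard_univ]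
  exact Set.ncard_lt_ncard (Set.ssubset_univ_iff.2 h)

/-- By maximality of `|B|`, the member on a proper subset `D` containing the range of `g` has a root
no larger than `B`, hence is the pullback of `u` along a retraction. By uniqueness these retractions
restrict to each other, so `f a` can be read off on `range g ∪ {a}`, which is proper since `|B| + 2
≤ |A|`. -/
theorem Family.exists_retraction {M : SymmetricSet.{u}} {A B : Type u} [Finite A] [Finite B]
    [Nonempty B] (X : Family M (fun B => Nat.card B < Nat.card A) A)
    (hB : Nat.card B < Nat.card A) {g : B → A} (hu : Nondeg M (X.val B hB g))
    (hmax : ∀ (C : Type u) [Finite C] [Nonempty C] (hC : Nat.card C < Nat.card A) (h : C → A),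
      Nondeg M (X.val C hC h) → Nat.card C ≤ Nat.card B)
    (hBA : Nat.card B + 2 ≤ Nat.card A) :
    ∃ f : A → B, f ∘ g = id ∧
      ∀ (C : Type u) [Finite C] [Nonempty C] (hC : Nat.card C < Nat.card A) (h : C → A)
        (D : Set A), D ≠ Set.univ → Set.range g ⊆ D → Set.range h ⊆ D →
        X.val C hC h = pull M (f ∘ h) (X.val B hB g) := by
  set u := X.val B hB g with hudef
  have ret (D : Set A) (hD : D ≠ Set.univ) (hgD : ∀ b, g b ∈ D) :
      ∃ r : D → B, (∀ b, r ⟨g b, hgD b⟩ = b) ∧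
        ∀ (C : Type u) [Finite C] [Nonempty C] (hC : Nat.card C < Nat.card A) (h : C → D),
          X.val C hC (Subtype.val ∘ h) = pull M (r ∘ h) u := by
    have hDc := card_lt_of_ne_univ hD
    have : Nonempty D := ⟨g (Classical.arbitrary B), hgD _⟩
    obtain ⟨C, _, _, q, y, hq, hy, hx⟩ := exists_root (X.val D hDc Subtype.val)
    obtain ⟨s, hs⟩ := exists_section hq
    have hyX : y = X.val C ((Nat.card_le_card_of_surjective _ hq).trans_lt hDc)
        (Subtype.val ∘ s) := by
      rw [← X.pull_val C D _ hDc, hx, pull_pull, hs, pull_id]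
    have hc := hmax C _ _ (hyX ▸ hy)
    obtain ⟨r, hr, hr'⟩ := hu.exists_retraction (j := fun b => (⟨g b, hgD b⟩ : D))
      (X.pull_val B D hB hDc _ _) hc hx
    refine ⟨r, congrFun hr, fun C _ _ hC h => ?_⟩
    rw [← X.pull_val C D hC hDc, hr', pull_pull]
  have hins (a : A) : insert a (Set.range g) ≠ Set.univ :=
    ne_univ_of_ncard_lt (((Set.ncard_insert_le _ _).trans
      (Nat.succ_le_succ (ncard_range_le g))).trans_lt (by lia))
  choose r hr hrX using fun a : A => ret _ (hins a) (fun b => Or.inr ⟨b, rfl⟩)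
  let f : A → B := fun a => r a ⟨a, Or.inl rfl⟩
  have hfr (D : Set A) (hD : D ≠ Set.univ) (hgD : ∀ b, g b ∈ D) (r' : D → B)
      (hr' : ∀ b, r' ⟨g b, hgD b⟩ = b)
      (hX' : ∀ (C : Type u) [Finite C] [Nonempty C] (hC : Nat.card C < Nat.card A) (h : C → D),
          X.val C hC (Subtype.val ∘ h) = pull M (r' ∘ h) u) (a : D) : r' a = f a := by
    have hsub : insert a.1 (Set.range g) ⊆ D := by
      rintro _ (rfl | ⟨b, rfl⟩)
      exacts [a.2, hgD b]
    have hc := card_lt_of_ne_univ (hins a.1)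
    have h1 := hX' _ hc (Set.inclusion hsub)
    have h2 := hrX a.1 _ hc id
    have := hu.retraction_unique (j := fun b => (⟨g b, Or.inr ⟨b, rfl⟩⟩ : ↥(insert a.1 (Set.range g))))
      (r := r' ∘ Set.inclusion hsub) (r' := r a.1 ∘ id) (funext hr') (funext (hr a.1))
      (h1.symm.trans h2)
    exact congrFun this ⟨a.1, Or.inl rfl⟩
  refine ⟨f, funext fun b => ?_, fun C _ _ hC h D hD hgD hhD => ?_⟩
  · exact hr (g b) b
  · have hgD' : ∀ b, g b ∈ D := fun b => hgD ⟨b, rfl⟩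
    obtain ⟨r', hr', hX'⟩ := ret D hD hgD'
    have h1 := hX' C hC (fun c => ⟨h c, hhD ⟨c, rfl⟩⟩)
    have h2 : r' ∘ (fun c => (⟨h c, hhD ⟨c, rfl⟩⟩ : D)) = f ∘ h :=
      funext fun c => hfr D hD hgD' r' hr' hX' _
    rw [h2] at h1
    exact h1

section

variable {M : SymmetricSet.{u}} {A B : Type u} [Finite A] [Finite B] [Nonempty B]

/-- If `i = g b`, replacing the value of `g` at `b` by `j` gives a `g'` with the same member that
avoids `i`. The retraction `f'` built from `g'` describes the family away from `i`, so it suffices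
that `f' = f`. This is checked on `range g ∪ {j, a}`, unless that is all of `A`. -/
theorem Family.val_eq_pull_of_apply_eq
    (X : Family M (fun B => Nat.card B < Nat.card A) A)
    (hB : Nat.card B < Nat.card A) {g : B → A} (hu : Nondeg M (X.val B hB g))
    (hmax : ∀ (C : Type u) [Finite C] [Nonempty C] (hC : Nat.card C < Nat.card A) (h : C → A),
      Nondeg M (X.val C hC h) → Nat.card C ≤ Nat.card B)
    (hBA : Nat.card B + 2 ≤ Nat.card A)
    (hBA' : Nat.card B + 3 ≤ Nat.card A ∨ Nat.card B ≤ 2)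
    {f : A → B} (hfg : f ∘ g = id)
    (hf : ∀ (C : Type u) [Finite C] [Nonempty C] (hC : Nat.card C < Nat.card A) (h : C → A)
        (D : Set A), D ≠ Set.univ → Set.range g ⊆ D → Set.range h ⊆ D →
        X.val C hC h = pull M (f ∘ h) (X.val B hB g))
    {i j : A} (hij : j ≠ i) (hfij : f j = f i) {C : Type u} [Finite C] [Nonempty C]
    (hC : Nat.card C < Nat.card A) {h : C → A} (hi : ∀ c, h c ≠ i) :
    X.val C hC h = pull M (f ∘ h) (X.val B hB g) := by
  classical
  have hfg' (b : B) : f (g b) = b := congrFun hfg b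
  have ne_of_not_mem {D : Set A} {a : A} (ha : a ∉ D) : D ≠ Set.univ := fun h => ha (h ▸ trivial)
  by_cases hig : i ∈ Set.range g
  swap
  · refine hf C hC h {a | a ≠ i} (ne_of_not_mem (a := i) (by simp)) ?_ ?_
    · rintro _ ⟨b, rfl⟩ hb
      exact hig ⟨b, hb⟩
    · rintro _ ⟨c, rfl⟩
      exact hi c
  obtain ⟨b, rfl⟩ := hig
  rw [hfg'] at hfij
  have hcard (a : A) : (insert a (Set.range g)).ncard ≤ Nat.card B + 1 :=
    (Set.ncard_insert_le _ _).trans (Nat.succ_le_succ (ncard_range_le g))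
  have hins (a : A) : insert a (Set.range g) ≠ Set.univ :=
    ne_univ_of_ncard_lt ((hcard a).trans_lt (by lia))
  have hupd (a : A) : Set.range (update g b a) ⊆ insert a (Set.range g) := by
    rintro _ ⟨c, rfl⟩
    by_cases hc : c = b
    · subst hc; simp
    · simp [hc]
  set g' := update g b j with hg'
  have hfg1 : f ∘ g' = id := by
    funext c
    by_cases hc : c = b
    · subst hc; simp [hg', hfij]
    · simp [hg', hc, hfg']
  have hu' : X.val B hB g' = X.val B hB g := by
    rw [hf B hB g' _ (hins j) (Set.subset_insert _ _) (hupd j), hfg1, pull_id]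
  obtain ⟨f', hfg2, hf'⟩ := X.exists_retraction hB (g := g') (hu' ▸ hu) hmax hBA
  rw [hu'] at hf'
  have hff : f' = f := by
    funext a
    by_cases hD : insert a (insert j (Set.range g)) = Set.univ
    swap
    · have h1 : Set.range g ⊆ insert a (insert j (Set.range g)) :=
        (Set.subset_insert _ _).trans (Set.subset_insert _ _)
      have h2 : Set.range g' ⊆ insert a (insert j (Set.range g)) :=
        (hupd j).trans (Set.subset_insert _ _)
      have hc := card_lt_of_ne_univ hD
      have : Nonempty ↥(insert a (insert j (Set.range g))) := ⟨a, Or.inl rfl⟩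
      have := hu.retraction_unique (r := f' ∘ Subtype.val) (r' := f ∘ Subtype.val)
        (j := fun c => (⟨g' c, h2 ⟨c, rfl⟩⟩ : ↥(insert a (insert j (Set.range g)))))
        hfg2 hfg1 ?_
      · exact congrFun this ⟨a, Or.inl rfl⟩
      · rw [← hf _ hc Subtype.val _ hD h1 Subtype.range_coe.le, ← hf' _ hc Subtype.val _ hD h2 Subtype.range_coe.le]
    · have hB2 : Nat.card B ≤ 2 := by
        refine hBA'.resolve_left fun h3 => ?_
        refine ne_univ_of_ncard_lt (lt_of_le_of_lt (Set.ncard_insert_le _ _) ?_) hD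
        have := hcard j
        lia
      have hab : a ≠ g b := by
        rintro rfl
        rw [Set.insert_eq_of_mem (Set.mem_insert_of_mem _ (Set.mem_range_self b))] at hD
        exact hins j hD
      have hfu {f : A → B} {g : B → A} (hfg : f ∘ g = id) :
          f ∘ update g b a = update id b (f a) := by
        funext c
        by_cases hc : c = b
        · subst hc; simp
        · simpa [hc] using congrFun hfg c
      -- Through `f` and `f'`, the member at `update g b a` is the pullback of the same
      -- non-degenerate element along `update id b (f a)` and `update id b (f' a)`. If either value
      -- is `b`, non-degeneracy forces the other to be `b`; otherwise two different values and `b`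
      -- would be three points of `B`.
      have e1 := hf B hB (update g b a) _ (hins a) (Set.subset_insert _ _) (hupd a)
      have e2 := hf' B hB (update g b a) {x | x ≠ g b} (ne_of_not_mem (a := g b) (by simp)) (by
          rintro _ ⟨c, rfl⟩
          by_cases hc : c = b
          · subst hc; simpa [hg'] using hij
          · simp only [hg', update_of_ne hc]
            exact fun h => hc (by rw [← hfg' c, h, hfg'])) (by
          rintro _ ⟨c, rfl⟩
          by_cases hc : c = b
          · subst hc; simpa using hab
          · simp only [update_of_ne hc]
            exact fun h => hc (by rw [← hfg' c, h, hfg']))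
      have e3 : update g b a = update g' b a := by simp [hg']
      rw [hfu hfg] at e1
      rw [e3, hfu hfg2, ← e3, e1] at e2
      have hid : update (id : B → B) b b = id := update_eq_self b id
      by_cases h1 : f' a = b
      · rw [h1, hid, pull_id] at e2
        rw [h1, hu.eq_of_pull_update_eq e2.symm]
      by_cases h2 : f a = b
      · rw [h2, hid, pull_id] at e2
        rw [h2, hu.eq_of_pull_update_eq e2]
      by_contra h3
      have := Set.ncard_le_card ({f' a, f a, b} : Set B)
      rw [Set.ncard_eq_three.2 ⟨_, _, _, h3, h1, h2, rfl⟩] at this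
      lia
  subst hff
  refine hf' C hC h {x | x ≠ g b} (ne_of_not_mem (a := g b) (by simp)) ?_ ?_
  · rintro _ ⟨c, rfl⟩
    by_cases hc : c = b
    · subst hc; simpa [hg'] using hij
    · simp only [hg', update_of_ne hc]
      exact fun h => hc (by rw [← hfg' c, h, hfg'])
  · rintro _ ⟨c, rfl⟩
    exact hi c

/-- The remaining case is a point `i` alone in its fibre of `f`. On its complement `D`, the member
`x` and the candidate `y` agree away from any point `k` sharing its fibre within `D`. If some such
`k` is redundant in `x`, then `x = y`; if none is, the root of `x` is too large. -/
theorem Family.exists_isFilledBy_of_nondeg [Nonempty A] (X : Family M (fun B => Nat.card B < Nat.card A) A)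
    (hB : Nat.card B < Nat.card A) {g : B → A} (hu : Nondeg M (X.val B hB g))
    (hmax : ∀ (C : Type u) [Finite C] [Nonempty C] (hC : Nat.card C < Nat.card A) (h : C → A),
      Nondeg M (X.val C hC h) → Nat.card C ≤ Nat.card B)
    (hBA : Nat.card B + 2 ≤ Nat.card A)
    (hBA' : Nat.card B + 3 ≤ Nat.card A ∨ Nat.card B ≤ 2)
    (hBA2 : 2 * Nat.card B ≤ Nat.card A + 1) : ∃ x, X.IsFilledBy x := by
  classical
  obtain ⟨f, hfg, hf⟩ := X.exists_retraction hB hu hmax hBA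
  have main {i j : A} (hij : j ≠ i) (hfij : f j = f i) {C : Type u} [Finite C] [Nonempty C]
      (hC : Nat.card C < Nat.card A) {h : C → A} (hi : ∀ c, h c ≠ i) :
      X.val C hC h = pull M (f ∘ h) (X.val B hB g) :=
    X.val_eq_pull_of_apply_eq hB hu hmax hBA hBA' hfg hf hij hfij hC hi
  suffices H : ∀ (i : A) (C : Type u) [Finite C] [Nonempty C] (hC : Nat.card C < Nat.card A)
      (h : C → A), (∀ c, h c ≠ i) → X.val C hC h = pull M (f ∘ h) (X.val B hB g) by
    refine ⟨pull M f (X.val B hB g), fun C _ _ hC h => ?_⟩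
    have : ¬ Surjective h := fun hs => hC.not_ge (Nat.card_le_card_of_surjective _ hs)
    simp only [Surjective, not_forall, not_exists] at this
    obtain ⟨i, hi⟩ := this
    rw [pull_pull, H i C hC h hi]
  intro i C _ _ hC h hi
  by_cases hsing : ∃ j, j ≠ i ∧ f j = f i
  · obtain ⟨j, hj, hfj⟩ := hsing
    exact main hj hfj hC hi
  push Not at hsing
  let D := {a : A // a ≠ i}
  have hDA : Nat.card D + 1 = Nat.card A := by
    have := Set.ncard_sdiff_singleton_add_one (Set.mem_univ i)
    rw [Set.ncard_univ, ← Nat.card_coe_set_eq] at this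
    rw [← this]
    congr 1
    exact Nat.card_congr (Equiv.subtypeEquivRight (by simp))
  have hD : Nat.card D < Nat.card A := by lia
  have : Nonempty D := by
    rw [← Finite.card_pos_iff]
    lia
  set x := X.val D hD Subtype.val with hxdef
  set y := pull M (f ∘ (Subtype.val : D → A)) (X.val B hB g) with hydef
  suffices hxy : x = y by
    have h1 := X.pull_val C D hC hD (fun c => ⟨h c, hi c⟩) Subtype.val
    rw [← hxdef, hxy, hydef, pull_pull] at h1
    exact h1.symm
  have agree {k j : D} (hjk : j ≠ k) (hfjk : f j = f k) (h : D → D) (hk : ∀ d, h d ≠ k) :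
      pull M h x = pull M h y := by
    rw [hxdef, hydef, X.pull_val D D hD hD, pull_pull]
    exact main (i := k) (j := j) (fun h => hjk (Subtype.ext h)) hfjk hD
      (fun d h => hk d (Subtype.ext h))
  have fix {k j : D} (hfjk : f j = f k) : pull M (update id k j) y = y := by
    rw [hydef, pull_pull]
    congr 1
    funext d
    by_cases hd : d = k
    · subst hd; simpa using hfjk
    · simp [hd]
  by_cases hex : ∃ k j k' : D, j ≠ k ∧ f j = f k ∧ k' ≠ k ∧ pull M (update id k k') x = x
  · obtain ⟨k, j, k', hjk, hfjk, hk', hxk⟩ := hex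
    exact eq_of_pull_update_eq hk' hjk (agree hjk hfjk) (agree hjk.symm hfjk.symm) hxk
      (fix hfjk) (fix hfjk.symm)
  push Not at hex
  exfalso
  obtain ⟨E, _, _, q, v, hq, hv, hxq⟩ := exists_root x
  obtain ⟨s, hs⟩ := exists_section hq
  have hvX : v = X.val E ((Nat.card_le_card_of_surjective _ hq).trans_lt hD)
      (Subtype.val ∘ s) := by
    rw [← X.pull_val E D _ hD, ← hxdef, hxq, pull_pull, hs, pull_id]
  have hEB := hmax E _ _ (hvX ▸ hv)
  -- No point of `K` is redundant in `x`, so `q` identifies it with no other point of `D`; hence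
  -- `|K| ≤ |E| ≤ |B|`.
  let K : Set D := {k | ∃ j : D, j ≠ k ∧ f j = f k}
  have hqK {k k' : D} (hk : k ∈ K) (hkk' : q k' = q k) : k' = k := by
    obtain ⟨j, hj, hfj⟩ := hk
    by_contra hne
    refine hex k j k' hj hfj hne ?_
    rw [hxq, pull_pull]
    congr 1
    funext d
    by_cases hd : d = k
    · subst hd; simpa using hkk'
    · simp [hd]
  have hKE : Nat.card K ≤ Nat.card E :=
    Nat.card_le_card_of_injective (fun k : K => q k)
      (fun k k' h => Subtype.ext (hqK k'.2 h))
  -- On `Kᶜ` the map `f` is injective and misses two values: `f i`, and the value at a collision of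
  -- `f`, which exists because `|B| < |A|`.
  have hKc : Nat.card ↥Kᶜ + 2 ≤ Nat.card B := by
    have hmem {d : ↥Kᶜ} {j : D} (h : f j = f d.1) : j = d.1 := by
      by_contra hne
      exact d.2 ⟨j, hne, h⟩
    have hnon : ∃ a a' : A, a ≠ a' ∧ f a = f a' := by
      by_contra hno
      push Not at hno
      have := Nat.card_le_card_of_injective f (fun a a' h => by
        by_contra hne
        exact hno a a' hne h)
      lia
    obtain ⟨a, a', haa, hfa⟩ := hnon
    have hai : a ≠ i := by
      rintro rfl
      exact hsing a' haa.symm hfa.symm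
    have hai' : a' ≠ i := by
      rintro rfl
      exact hsing a haa hfa
    have hsub : Set.range (fun d : ↥Kᶜ => f d.1) ⊆ (Set.univ \ {f i}) \ {f a} := by
      rintro _ ⟨d, rfl⟩
      refine ⟨⟨trivial, fun h => hsing d.1.1 d.1.2 h⟩, fun h => haa ?_⟩
      have h1 : (⟨a, hai⟩ : D) = d.1 := hmem h.symm
      have h2 : (⟨a', hai'⟩ : D) = d.1 := hmem (hfa.symm.trans h.symm)
      exact congrArg Subtype.val (h1.trans h2.symm)
    have h1 := Set.ncard_le_ncard hsub
    have h2 : (Set.range (fun d : ↥Kᶜ => f d.1)).ncard = Nat.card ↥Kᶜ := by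
      rw [← Set.image_univ, Set.ncard_image_of_injective _ ?_, Set.ncard_univ]
      intro d d' h
      exact Subtype.ext (hmem h)
    have h3 := Set.ncard_sdiff_singleton_add_one (Set.mem_univ (f i))
    have h4 := Set.ncard_sdiff_singleton_add_one
      (show f a ∈ Set.univ \ {f i} from ⟨trivial, fun h => hsing a hai h⟩)
    rw [Set.ncard_univ] at h3
    lia
  have hsum : Nat.card K + Nat.card ↥Kᶜ = Nat.card D := by
    rw [Nat.card_coe_set_eq, Nat.card_coe_set_eq, Set.ncard_add_ncard_compl]
  -- The estimates give `|D| ≤ 2|B| - 2`, and `hBA2` gives the reverse, so `|K| = |E| = |B|`. Then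
  -- `Kᶜ` is empty and `|A| = |B| + 1`, against `hBA`.
  have hbij : Surjective (fun k : K => q k) := by
    refine ((Nat.bijective_iff_injective_and_card _).2 ⟨?_, ?_⟩).2
    · exact fun k k' h => Subtype.ext (hqK k'.2 h)
    · lia
  have hKuniv : Nat.card ↥Kᶜ = 0 := by
    have : IsEmpty ↥Kᶜ := ⟨fun d => by
      obtain ⟨k, hk⟩ := hbij (q d.1)
      exact d.2 (by rw [hqK k.2 hk.symm]; exact k.2)⟩
    exact Nat.card_of_isEmpty
  lia

end

/-- A family of elements with roots of size at most `l + 1`, indexed by the functions from all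
smaller sets, can be filled if the target is large enough. -/
theorem Family.exists_isFilledBy {M : SymmetricSet.{u}} {l : ℕ}
    (hM : ∀ (A : Type u) [Finite A] [Nonempty A] (x : El M A),
      ∃ (B : Type u) (_ : Finite B) (_ : Nonempty B) (f : A → B) (z : El M B),
        Nat.card B ≤ l + 1 ∧ x = pull M f z)
    {A : Type u} [Finite A] [Nonempty A] (X : Family M (fun B => Nat.card B < Nat.card A) A)
    (h1 : l + 3 ≤ Nat.card A) (h2 : l + 4 ≤ Nat.card A ∨ l ≤ 1) (h3 : 2 * l + 1 ≤ Nat.card A) :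
    ∃ x, X.IsFilledBy x := by
  let P (m : ℕ) : Prop := ∃ (B : Type u) (_ : Finite B) (_ : Nonempty B)
    (hB : Nat.card B < Nat.card A) (g : B → A), Nondeg M (X.val B hB g) ∧ Nat.card B = m
  have hP1 : P 1 := by
    refine ⟨PUnit, inferInstance, inferInstance, ?_, fun _ => Classical.arbitrary A, ?_, ?_⟩
    · rw [Nat.card_unique]
      lia
    · exact fun C _ _ g z _ => injective_of_subsingleton g
    · exact Nat.card_unique
  have hPl {m : ℕ} (hm : P m) : m ≤ l + 1 := by
    obtain ⟨B, _, _, hB, g, hu, rfl⟩ := hm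
    obtain ⟨C, _, _, f, z, hC, hz⟩ := hM B (X.val B hB g)
    exact (hu.card_le hz).trans hC
  classical
  obtain ⟨B, _, _, hB, g, hu, hm⟩ := Nat.findGreatest_spec (P := P) (hPl hP1) hP1
  have hBl : Nat.card B ≤ l + 1 := hm ▸ Nat.findGreatest_le _
  refine X.exists_isFilledBy_of_nondeg hB hu (fun C _ _ hC h hv => ?_) (by lia) (by lia) (by lia)
  have hPC : P (Nat.card C) := ⟨C, _, _, hC, h, hv, rfl⟩
  rw [hm]
  exact Nat.le_findGreatest (hPl hPC) hPC

/-- Fillers over smaller sets, unique and hence compatible, extend the family from sets of size at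
most `k` to all sets smaller than `A`. -/
theorem Family.existsUnique_isFilledBy {M : SymmetricSet.{u}} {l k : ℕ}
    (hM : ∀ (A : Type u) [Finite A] [Nonempty A] (x : El M A),
      ∃ (B : Type u) (_ : Finite B) (_ : Nonempty B) (f : A → B) (z : El M B),
        Nat.card B ≤ l + 1 ∧ x = pull M f z)
    (h1 : l + 2 ≤ k) (h2 : l + 3 ≤ k ∨ l ≤ 1) (h3 : 2 * l ≤ k)
    (A : Type u) [Finite A] [Nonempty A] (X : Family M (fun B => Nat.card B ≤ k) A) :
    ∃! x, X.IsFilledBy x := by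
  have huniq (A : Type u) [Finite A] [Nonempty A] (x y : El M A)
      (h : ∀ (B : Type u) [Finite B] [Nonempty B] (g : B → A), Nat.card B ≤ k →
        pull M g x = pull M g y) : x = y :=
    eq_of_forall_pull_eq (hM A x) (hM A y) (fun B _ _ g hB => h B g (by lia))
  refine existsUnique_of_exists_of_unique ?_ (fun x y hx hy =>
    huniq A x y fun B _ _ g hB => (hx B hB g).trans (hy B hB g).symm)
  induction hn : Nat.card A using Nat.strong_induction_on generalizing A with
  | _ n ih =>
    subst hn
    by_cases hA : Nat.card A ≤ k
    · exact ⟨X.val A hA id, fun B _ _ hB g => X.pull_val B A hB hA g id⟩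
    have hY (B : Type u) (_ : Finite B) (_ : Nonempty B) (hB : Nat.card B < Nat.card A)
        (g : B → A) : ∃ y : El M B, ∀ (C : Type u) [Finite C] [Nonempty C]
          (hC : Nat.card C ≤ k) (h : C → B), pull M h y = X.val C hC (g ∘ h) :=
      ih _ hB B ⟨fun C _ _ hC h => X.val C hC (g ∘ h),
        fun C D _ _ _ _ hC hD f h => X.pull_val C D hC hD f (g ∘ h)⟩ rfl
    choose Y hY using hY
    let Z : Family M (fun B => Nat.card B < Nat.card A) A :=
      ⟨fun B _ _ hB g => Y B _ _ hB g, fun B C _ _ _ _ hB hC f g =>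
        huniq B _ _ fun D _ _ h hD => by rw [pull_pull, hY _ _ _ _ _ _ hD, hY _ _ _ _ _ _ hD]; rfl⟩
    obtain ⟨x, hx⟩ := Z.exists_isFilledBy hM (by lia) (by lia) (by lia)
    refine ⟨x, fun B _ _ hB g => ?_⟩
    have hBA : Nat.card B < Nat.card A := by lia
    rw [hx B hBA g]
    have := hY B inferInstance inferInstance hBA g B hB id
    rwa [pull_id] at this

/-! ### Labels -/

theorem small_natCast_iff {k : ℕ} {A : Type u} :
    Small ((k : ℕ∞) : Label) A ↔ Nat.card A ≤ k + 1 := by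
  unfold Small
  norm_cast

theorem not_small_bot {A : Type u} [Finite A] [Nonempty A] : ¬ Small ⊥ A := by
  unfold Small
  simp

theorem isCoskeletal_of_isSkeletal {l k : ℕ} (h1 : l + 1 ≤ k) (h2 : l + 2 ≤ k ∨ l ≤ 1)
    (h3 : 2 * l ≤ k + 1) {M : SymmetricSet.{u}} (hM : IsSkeletal ((l : ℕ∞) : Label) M) :
    IsCoskeletal ((k : ℕ∞) : Label) M := by
  refine isCoskeletal_of_existsUnique ?_
  have : Small.{u} ((k : ℕ∞) : Label) = fun B => Nat.card B ≤ k + 1 :=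
    funext fun B => propext small_natCast_iff
  rw [this]
  refine Family.existsUnique_isFilledBy (l := l) (fun A _ _ x => ?_) (by lia) (by lia) (by lia)
  obtain ⟨B, _, _, f, y, hB, hx⟩ := factorsThrough_of_isSkeletal hM x
  exact ⟨B, _, _, f, y, small_natCast_iff.1 hB, hx⟩

/-! ### The symmetric sets of systems of transversals -/

/-- The transversals, in all possible orders, of the partition of `A` into the fibres of
`f : A → Fin (l + 1)`. -/
def transversals {l : ℕ} {A : Type*} (f : A → Fin (l + 1)) : Set (Fin (l + 1) → A) :=
  {t | Function.Injective (f ∘ t)}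

/-- The symmetric set with one non-degenerate element `σ` in dimension `l`, which is fixed by all
permutations, and all of whose faces come from a single point (distinct from `σ` if `l = 0`). An
element over `A` is identified with the set of those `t : Fin (l + 1) → A` along which its pullback
is `σ`. -/
def transversalSystem (l : ℕ) : SymmetricSet.{u} :=
  ofAction
    (fun A _ _ => {T : Set (Fin (l + 1) → A) // T = ∅ ∨ ∃ f : A → Fin (l + 1), T = transversals f})
    (fun h T => ⟨{t | h ∘ t ∈ T.1}, by
      obtain ⟨_, rfl | ⟨f, rfl⟩⟩ := T
      · exact Or.inl rfl
      · exact Or.inr ⟨f ∘ h, rfl⟩⟩)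
    (fun _ => rfl) (fun _ _ _ => rfl)

theorem isSkeletal_transversalSystem (l : ℕ) :
    IsSkeletal ((l : ℕ∞) : Label) (transversalSystem.{u} l) := by
  refine isSkeletal_of_factorsThrough fun A _ _ x => ?_
  obtain ⟨_, rfl | ⟨f, rfl⟩⟩ := x
  · refine ⟨PUnit, inferInstance, inferInstance, fun _ => PUnit.unit, ⟨∅, Or.inl rfl⟩, ?_, ?_⟩
    · rw [small_natCast_iff, Nat.card_unique]
      lia
    · rfl
  · refine ⟨ULift (Fin (l + 1)), inferInstance, inferInstance, ULift.up ∘ f,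
      ⟨transversals ULift.down, Or.inr ⟨_, rfl⟩⟩, ?_, ?_⟩
    · rw [small_natCast_iff]
      simp
    · rfl

/-- A set of functions to `V` that is locally, but not globally, a system of transversals gives a
lower bound for the Aufhebung. -/
theorem card_le_of_isCoskeletal_transversalSystem {l b : ℕ} (hlb : l ≤ b)
    (h : IsCoskeletal ((b : ℕ∞) : Label) (transversalSystem.{u} l)) {V : Type} [Finite V]
    [Nonempty V] (T : Set (Fin (l + 1) → V))
    (hT : ∀ i : V, (∀ t ∈ T, ∃ j, t j = i) ∨
      ∃ f : V → Fin (l + 1), ∀ t, (∀ j, t j ≠ i) → (t ∈ T ↔ Function.Injective (f ∘ t)))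
    (hT₀ : T.Nonempty) (hT₁ : ∀ f : V → Fin (l + 1), T ≠ transversals f) :
    Nat.card V ≤ b + 1 := by
  by_contra! hV
  let X : Family (transversalSystem.{u} l) (Small ((b : ℕ∞) : Label)) (ULift.{u} V) :=
    { val := fun B _ _ hB g => ⟨{t | ULift.down ∘ g ∘ t ∈ T}, by
        rw [small_natCast_iff] at hB
        -- A map from a set of at most `b + 1` elements misses a point of `V`, so the local
        -- hypothesis `hT` applies.
        have : ¬ Surjective (ULift.down ∘ g) := fun hs =>
          (hB.trans_lt hV).not_ge (Nat.card_le_card_of_surjective _ hs)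
        simp only [Surjective, not_forall, not_exists] at this
        obtain ⟨i, hi⟩ := this
        rcases hT i with hi' | ⟨f, hf⟩
        · refine Or.inl (Set.eq_empty_of_forall_notMem fun t ht => ?_)
          obtain ⟨j, hj⟩ := hi' _ ht
          exact hi _ hj
        · exact Or.inr ⟨f ∘ ULift.down ∘ g, Set.ext fun t => hf _ fun j => hi (t j)⟩⟩
      pull_val := fun _ _ _ _ _ _ _ _ _ _ => rfl }
  obtain ⟨x, hx⟩ := exists_isFilledBy_of_isCoskeletal h X
  have key (t : Fin (l + 1) → V) : ULift.up ∘ t ∈ x.1 ↔ t ∈ T := by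
    have := congrArg (fun y => (ULift.up : Fin (l + 1) → ULift.{u} (Fin (l + 1))) ∈ y.1)
      (hx (ULift.{u} (Fin (l + 1))) (small_natCast_iff.2 (by simpa using hlb))
        (ULift.up ∘ t ∘ ULift.down))
    exact this.to_iff
  obtain ⟨x, rfl | ⟨f, rfl⟩⟩ := x
  · obtain ⟨t, ht⟩ := hT₀
    exact (key t).2 ht
  · exact hT₁ (f ∘ ULift.up) (Set.ext fun t => (key t).symm)

/-- The Aufhebung of a finite level, from a bound in each direction. -/
theorem isAufhebung_natCast {l a : ℕ} (h1 : l + 1 ≤ a) (h2 : l + 2 ≤ a ∨ l ≤ 1)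
    (h3 : 2 * l ≤ a + 1)
    (h : ∀ b : ℕ, l ≤ b → IsCoskeletal ((b : ℕ∞) : Label) (transversalSystem.{u} l) → a ≤ b) :
    IsAufhebung.{u} ((l : ℕ∞) : Label) ((a : ℕ∞) : Label) := by
  refine ⟨⟨?_, fun M hM => isCoskeletal_of_isSkeletal h1 h2 h3 hM⟩, ?_⟩
  · exact_mod_cast (by lia : l ≤ a)
  · rintro b ⟨hlb, hb⟩
    have hb' := hb _ (isSkeletal_transversalSystem l)
    induction b using WithBot.recBotCoe with
    | bot => simp at hlb
    | coe b =>
      induction b using ENat.recTopCoe with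
      | top => exact_mod_cast le_top
      | coe b => exact_mod_cast h b (by exact_mod_cast hlb) hb'

/-! ### Local systems of transversals that are not global -/

theorem one_le_of_isCoskeletal {b : ℕ}
    (h : IsCoskeletal ((b : ℕ∞) : Label) (transversalSystem.{u} 0)) : 1 ≤ b := by
  have := card_le_of_isCoskeletal_transversalSystem b.zero_le h (V := Bool) {t | t 0 = true}
    (fun i => by
      cases i
      · exact Or.inr ⟨fun _ => 0, fun t ht => iff_of_true (by simpa using ht 0)
          (injective_of_subsingleton (α := Fin 1) _)⟩
      · exact Or.inl fun t ht => ⟨0, ht⟩)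
    ⟨fun _ => true, rfl⟩
    (fun f hf => by
      have : (fun _ => false) ∈ transversals f :=
        injective_of_subsingleton (α := Fin 1) _
      rw [← hf] at this
      simp at this)
  simpa using this

theorem injective_fin_two_iff {α : Type*} {t : Fin 2 → α} :
    Function.Injective t ↔ t 0 ≠ t 1 := by
  refine ⟨fun h => h.ne zero_ne_one, fun h i j hij => ?_⟩
  fin_cases i <;> fin_cases j <;> simp_all

theorem injective_fin_three_iff {α : Type*} {t : Fin 3 → α} :
    Function.Injective t ↔ t 0 ≠ t 1 ∧ t 0 ≠ t 2 ∧ t 1 ≠ t 2 := by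
  refine ⟨fun h => ⟨h.ne (by decide), h.ne (by decide), h.ne (by decide)⟩, fun h i j hij => ?_⟩
  fin_cases i <;> fin_cases j <;> simp_all

/-- Three points are pairwise separated by a map to two points once one of them is removed, but not
all at once. -/
theorem two_le_of_isCoskeletal {b : ℕ} (hb : 1 ≤ b)
    (h : IsCoskeletal ((b : ℕ∞) : Label) (transversalSystem.{u} 1)) : 2 ≤ b := by
  have h3 : ∀ i : Fin 3, ∃ f : Fin 3 → Fin 2, ∀ x y, x ≠ i → y ≠ i → (x ≠ y ↔ f x ≠ f y) := by
    decide
  have := card_le_of_isCoskeletal_transversalSystem hb h (V := Fin 3) {t | t 0 ≠ t 1}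
    (fun i => by
      obtain ⟨f, hf⟩ := h3 i
      exact Or.inr ⟨f, fun t ht => (hf _ _ (ht 0) (ht 1)).trans (injective_fin_two_iff (t := f ∘ t)).symm⟩)
    ⟨![0, 1], zero_ne_one (α := Fin 3)⟩
    (fun f hf => by
      have hinj : Function.Injective f := fun x y hxy => by
        by_contra hne
        have : ![x, y] ∈ transversals f := hf ▸ hne
        exact injective_fin_two_iff.1 this hxy
      simpa using Fintype.card_le_of_injective f hinj)
  simpa using this

/-- The identification of two vertices of a pentagon that leaves the vertices other than `0` with
just two triples of consecutive vertices. -/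
def pentagonFold : Fin 5 → Fin 3 := ![0, 0, 1, 2, 0]

/-- The product of the squares of the differences is `4` if and only if `x`, `y`, `z` are
consecutive vertices of a pentagon, in some order. -/
theorem pentagon_iff (i x : Fin 5) (hx : x ≠ i) (y : Fin 5) (hy : y ≠ i) (z : Fin 5) (hz : z ≠ i) :
    ((x - y) * (x - z) * (y - z)) ^ 2 = 4 ↔
      pentagonFold (x - i) ≠ pentagonFold (y - i) ∧
      pentagonFold (x - i) ≠ pentagonFold (z - i) ∧
      pentagonFold (y - i) ≠ pentagonFold (z - i) := by
  revert i x y z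
  decide

theorem four_le_of_isCoskeletal {b : ℕ} (hb : 2 ≤ b)
    (h : IsCoskeletal ((b : ℕ∞) : Label) (transversalSystem.{u} 2)) : 4 ≤ b := by
  have := card_le_of_isCoskeletal_transversalSystem hb h (V := Fin 5)
    {t | ((t 0 - t 1) * (t 0 - t 2) * (t 1 - t 2)) ^ 2 = 4}
    (fun i => Or.inr ⟨fun x => pentagonFold (x - i), fun t ht =>
      (pentagon_iff i _ (ht 0) _ (ht 1) _ (ht 2)).trans (injective_fin_three_iff (t := (fun x => pentagonFold (x - i)) ∘ t)).symm⟩)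
    ⟨![0, 1, 2], show _ = _ by decide⟩
    (fun f hf => by
      have key {x y z : Fin 5} (hxyz : ((x - y) * (x - z) * (y - z)) ^ 2 = 4) :
          f x ≠ f y ∧ f x ≠ f z ∧ f y ≠ f z :=
        have : ![x, y, z] ∈ transversals f := hf ▸ hxyz
        injective_fin_three_iff.1 this
      -- With only three values, the first two triples force `f 0 = f 3`, which the last one
      -- forbids.
      have h0 := key (x := 0) (y := 1) (z := 2) (by decide)
      have h1 := key (x := 1) (y := 2) (z := 3) (by decide)
      have h3 := key (x := 3) (y := 4) (z := 0) (by decide)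
      lia)
  simpa using this

/-- `fL` collapses the left copy and separates the right one, and `fR` does the opposite. A
transversal of `fR` uses the whole left copy, so removing a left point leaves only those of `fL`,
and symmetrically. A global `f` would be injective, impossible as `2 * l > l + 1`. -/
theorem two_mul_sub_one_le_of_isCoskeletal {l b : ℕ} (hl : 2 ≤ l) (hb : l ≤ b)
    (h : IsCoskeletal ((b : ℕ∞) : Label) (transversalSystem.{u} l)) : 2 * l - 1 ≤ b := by
  let fL : Fin l ⊕ Fin l → Fin (l + 1) := Sum.elim (fun _ => Fin.last l) Fin.castSucc
  let fR : Fin l ⊕ Fin l → Fin (l + 1) := Sum.elim Fin.castSucc (fun _ => Fin.last l)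
  have : Nonempty (Fin l ⊕ Fin l) := ⟨Sum.inl ⟨0, by lia⟩⟩
  let tL (k : Fin l) : Fin (l + 1) → Fin l ⊕ Fin l := Fin.lastCases (Sum.inl k) Sum.inr
  let tR (k : Fin l) : Fin (l + 1) → Fin l ⊕ Fin l := Fin.lastCases (Sum.inr k) Sum.inl
  have htL (k : Fin l) : tL k ∈ transversals fL := by
    have : fL ∘ tL k = id := by
      funext i
      induction i using Fin.lastCases <;> simp [fL, tL]
    rw [transversals, Set.mem_ofPred_eq, this]
    exact injective_id
  have htR (k : Fin l) : tR k ∈ transversals fR := by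
    have : fR ∘ tR k = id := by
      funext i
      induction i using Fin.lastCases <;> simp [fR, tR]
    rw [transversals, Set.mem_ofPred_eq, this]
    exact injective_id
  have hsurj {f : Fin l ⊕ Fin l → Fin (l + 1)} {t : Fin (l + 1) → Fin l ⊕ Fin l}
      (ht : Function.Injective (f ∘ t)) : Surjective (f ∘ t) := Finite.injective_iff_surjective.1 ht
  have := card_le_of_isCoskeletal_transversalSystem hb h (transversals fL ∪ transversals fR)
    (fun i => Or.inr (by
      rcases i with i | i
      · refine ⟨fL, fun t ht => ⟨?_, Or.inl⟩⟩
        rintro (h | h)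
        · exact h
        · obtain ⟨j, hj⟩ := hsurj h i.castSucc
          refine absurd ?_ (ht j)
          rw [comp_def] at hj
          cases htj : t j with
          | inl k => simpa [fR, htj] using hj
          | inr k => simp [fR, htj, (Fin.castSucc_lt_last i).ne'] at hj
      · refine ⟨fR, fun t ht => ⟨?_, Or.inr⟩⟩
        rintro (h | h)
        · obtain ⟨j, hj⟩ := hsurj h i.castSucc
          refine absurd ?_ (ht j)
          rw [comp_def] at hj
          cases htj : t j with
          | inl k => simp [fL, htj, (Fin.castSucc_lt_last i).ne'] at hj
          | inr k => simpa [fL, htj] using hj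
        · exact h))
    ⟨tL ⟨0, by lia⟩, Or.inl (htL _)⟩
    (fun f hf => by
      have hL (k : Fin l) : Function.Injective (f ∘ tL k) :=
        show tL k ∈ transversals f from hf ▸ Or.inl (htL k)
      have hR (k : Fin l) : Function.Injective (f ∘ tR k) :=
        show tR k ∈ transversals f from hf ▸ Or.inr (htR k)
      have hinj : Function.Injective f := by
        rintro (i | i) (j | j) hij
        · have := hR i (a₁ := i.castSucc) (a₂ := j.castSucc) (by simpa [tR] using hij)
          rw [Fin.castSucc_injective l this]
        · have := hL i (a₁ := Fin.last l) (a₂ := j.castSucc) (by simpa [tL] using hij)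
          exact absurd this (Fin.castSucc_lt_last j).ne'
        · have := hR i (a₁ := Fin.last l) (a₂ := j.castSucc) (by simpa [tR] using hij)
          exact absurd this (Fin.castSucc_lt_last j).ne'
        · have := hL i (a₁ := i.castSucc) (a₂ := j.castSucc) (by simpa [tL] using hij)
          rw [Fin.castSucc_injective l this]
      have := Fintype.card_le_of_injective f hinj
      simp only [Fintype.card_sum, Fintype.card_fin] at this
      lia)
  simp only [Nat.card_eq_fintype_card, Fintype.card_sum, Fintype.card_fin] at this
  lia

/-- Only the empty presheaf is skeletal here. A family over a non-empty set has a member over a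
point, so it cannot exist at level `0`; at level `⊥` the empty family exists and has no filler. -/
theorem isAufhebung_bot : IsAufhebung.{u} ⊥ 0 := by
  refine ⟨⟨bot_le, fun M hM => ?_⟩, ?_⟩
  · have hE (A : Type u) [Finite A] [Nonempty A] (x : El M A) : False := by
      obtain ⟨B, _, _, _, _, hB, _⟩ := factorsThrough_of_isSkeletal hM x
      exact not_small_bot hB
    refine isCoskeletal_of_existsUnique fun A _ _ X => (hE PUnit (X.val PUnit ?_ ?_)).elim
    · exact (small_natCast_iff (k := 0)).2 (by simp)
    · exact fun _ => Classical.arbitrary A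
  · rintro b ⟨-, hb⟩
    induction b using WithBot.recBotCoe with
    | bot =>
      let M : SymmetricSet.{u} := ofAction (fun _ _ _ => PEmpty) (fun _ => id) (fun _ => rfl)
        (fun _ _ _ => rfl)
      have hM : IsSkeletal ⊥ M := isSkeletal_of_factorsThrough fun A _ _ x => PEmpty.elim x
      obtain ⟨x, -⟩ := exists_isFilledBy_of_isCoskeletal (hb M hM) (A := PUnit)
        ⟨fun B _ _ hB _ => (not_small_bot hB).elim,
          fun B _ _ _ _ _ hB => (not_small_bot hB).elim⟩
      exact PEmpty.elim x
    | coe b => exact_mod_cast (zero_le : (0 : ℕ∞) ≤ b)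

end SymmSet

theorem mainTheorem1 :
    SymmSet.IsAufhebung.{u} ⊥ 0 ∧
    SymmSet.IsAufhebung.{u} 0 1 ∧
    SymmSet.IsAufhebung.{u} 1 2 ∧
    SymmSet.IsAufhebung.{u} 2 4 ∧
    ∀ l : ℕ, 3 ≤ l →
      SymmSet.IsAufhebung.{u} ((l : ℕ∞) : SymmSet.Label) (((2 * l - 1 : ℕ) : ℕ∞) : SymmSet.Label) := by
  refine ⟨SymmSet.isAufhebung_bot, ?_, ?_, ?_, fun l hl => ?_⟩
  · exact SymmSet.isAufhebung_natCast (l := 0) (a := 1) (by lia) (by lia) (by lia)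
      fun b _ h => SymmSet.one_le_of_isCoskeletal h
  · exact SymmSet.isAufhebung_natCast (l := 1) (a := 2) (by lia) (by lia) (by lia)
      fun b hb h => SymmSet.two_le_of_isCoskeletal hb h
  · exact SymmSet.isAufhebung_natCast (l := 2) (a := 4) (by lia) (by lia) (by lia)
      fun b hb h => SymmSet.four_le_of_isCoskeletal hb h
  · exact SymmSet.isAufhebung_natCast (by lia) (by lia) (by lia)
      fun b hb h => SymmSet.two_mul_sub_one_le_of_isCoskeletal (by lia) hb h
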